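/- A (nonunital) operator system is a linear subspace $\mathfrak A\subseteq\mathbb R^{\nu\times\nu}$ closed under the transpose $*$; write $\mathfrak A_{\succeq 0}$ for the set of its symmetric positive semidefinite elements. Let $\mathfrak A\subseteq\mathbb R^{\nu\times\nu}$ and $\mathfrak B\subseteq\mathbb R^{\ell\times\ell}$ be operator systems with $\mathfrak A_{\succeq 0}\neq\{0\}$, and let $\tau:\mathfrak A\to\mathfrak B$ be a linear map with $\tau(A^*)=\tau(A)^*$ for all $A\in\mathfrak A$. The map $\tau$ is completely positive if $\tau$ and all its ampliations $\tau\otimes\mathrm{Id}_k:M_k(\mathfrak A)\to M_k(\mathfrak B)$, $k\in\mathbb N$, map positive semidefinite matrices to positive semidefinite matrices. Let $A_0,\dots,A_{s-1},A_s,\dots,A_g$ (with $1\le s\le g+1$) be a basis of $\mathfrak A$ such that $A_0,\dots,A_{s-1}$ are symmetric, $A_s,\dots,A_g$ are skew-symmetric, $A_0\ne 0$ is positive semidefinite and has maximal rank among the elements of $\mathfrak A_{\succeq 0}$, and $\operatorname{Tr}(A_i^*A_j)=0$ for all $0\le i\ne j\le s-1$. Let $$L_{\mathfrak A}(x)=A_0+\sum_{j=1}^{s-1}A_j(x_j+x_j^*)+\sum_{j=s}^{g}A_j(x_j-x_j^*),\qquad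 L_{\mathfrak B}(x)=\tau(A_0)+\sum_{j=1}^{s-1}\tau(A_j)(x_j+x_j^*)+\sum_{j=s}^{g}\tau(A_j)(x_j-x_j^*)$$ be the associated linear pencils in the noncommuting variables $x_1,\dots,x_g,x_1^*,\dots,x_g^*$. For $L\in\{L_{\mathfrak A},L_{\mathfrak B}\}$ and $X=(X_1,\dots,X_g)\in(\mathbb R^{n\times n})^g$ let $L(X)$ be obtained by substituting $X_j$ for $x_j$, $X_j^*$ for $x_j^*$ and the identity $I_n$ for $1$, the coefficients being multiplied by Kronecker products, and put $\mathcal D_L(n)=\{X\in(\mathbb R^{n\times n})^g : L(X)\succeq 0\}$ and $\mathcal D_L=\bigcup_{n}\mathcal D_L(n)$. Then the following are equivalent: (i) $\tau$ is completely positive; (ii) $\mathcal D_{L_{\mathfrak A}}\subseteq\mathcal D_{L_{\mathfrak B}}$; (iii) $\mathcal D_{L_{\mathfrak A}}(\ell)\subseteq\mathcal D_{L_{\mathfrak B}}(\ell)$. -/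

import Mathlib

/-- A (nonunital) operator system: a real subspace of `ν × ν` matrices closed under transposition. -/
def IsOperatorSystem {ν : ℕ} (𝔄 : Submodule ℝ (Matrix (Fin ν) (Fin ν) ℝ)) : Prop :=
  ∀ A ∈ 𝔄, Matrix.transpose A ∈ 𝔄

/-- The set of positive semidefinite (in particular symmetric) elements of `𝔄`. -/
def psdPart {ν : ℕ} (𝔄 : Submodule ℝ (Matrix (Fin ν) (Fin ν) ℝ)) :
    Set (Matrix (Fin ν) (Fin ν) ℝ) :=
  {A | A ∈ 𝔄 ∧ A.PosSemidef}

/-- A linear map between operator systems is a `*`-map if it commutes with transposition. -/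
def IsStarMap {ν l : ℕ} {𝔄 : Submodule ℝ (Matrix (Fin ν) (Fin ν) ℝ)}
    {𝔅 : Submodule ℝ (Matrix (Fin l) (Fin l) ℝ)} (h𝔄 : IsOperatorSystem 𝔄)
    (τ : 𝔄 →ₗ[ℝ] 𝔅) : Prop :=
  ∀ A : 𝔄, (τ ⟨Matrix.transpose A.1, h𝔄 A.1 A.2⟩ : Matrix (Fin l) (Fin l) ℝ) =
    Matrix.transpose (τ A).1

/-- An element of `M_k(𝔄)`, i.e. a `k × k` block matrix with blocks in `𝔄`,
regarded as a real matrix of size `kν × kν`. -/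
def flatten {ν k : ℕ} {𝔄 : Submodule ℝ (Matrix (Fin ν) (Fin ν) ℝ)}
    (S : Matrix (Fin k) (Fin k) 𝔄) : Matrix (Fin k × Fin ν) (Fin k × Fin ν) ℝ :=
  Matrix.of fun p q => (S p.1 q.1).1 p.2 q.2

/-- Positive maps. -/
def IsPositiveMap {ν l : ℕ} {𝔄 : Submodule ℝ (Matrix (Fin ν) (Fin ν) ℝ)}
    {𝔅 : Submodule ℝ (Matrix (Fin l) (Fin l) ℝ)} (τ : 𝔄 →ₗ[ℝ] 𝔅) : Prop :=
  ∀ A : 𝔄, A.1.PosSemidef → (τ A).1.PosSemidef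

/-- Completely positive maps: `τ` is positive and so are all its ampliations
`M_k(𝔄) → M_k(𝔅)`, which apply `τ` to every block. -/
def IsCompletelyPositive {ν l : ℕ} {𝔄 : Submodule ℝ (Matrix (Fin ν) (Fin ν) ℝ)}
    {𝔅 : Submodule ℝ (Matrix (Fin l) (Fin l) ℝ)} (τ : 𝔄 →ₗ[ℝ] 𝔅) : Prop :=
  IsPositiveMap τ ∧
    ∀ (k : ℕ) (S : Matrix (Fin k) (Fin k) 𝔄),
      (flatten S).PosSemidef → (flatten (S.map τ)).PosSemidef

/-- Noncommutative polynomials in `x_1, …, x_g, x_1^*, …, x_g^*` with real coefficients.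
The generator `Sum.inl j` is the variable `x_j`, the generator `Sum.inr j` is `x_j^*`. -/
abbrev NCPoly (g : ℕ) : Type := FreeAlgebra ℝ (Fin g ⊕ Fin g)

/-- Evaluation of a noncommutative polynomial at a tuple of real `n × n` matrices:
`x_j` is replaced by `X_j`, `x_j^*` by the transpose of `X_j`, and `1` by the identity. -/
noncomputable def evalNC {g n : ℕ} (X : Fin g → Matrix (Fin n) (Fin n) ℝ) :
    NCPoly g →ₐ[ℝ] Matrix (Fin n) (Fin n) ℝ :=
  FreeAlgebra.lift ℝ (Sum.elim X fun j => Matrix.transpose (X j))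

/-- Evaluation of a `μ × μ` matrix of noncommutative polynomials `p = ∑ A_w ⊗ w`:
the matrix `p(X) = ∑ A_w ⊗ w(X)` (Kronecker products), of size `μn × μn`. -/
noncomputable def evalMat {μ g n : ℕ} (p : Matrix (Fin μ) (Fin μ) (NCPoly g))
    (X : Fin g → Matrix (Fin n) (Fin n) ℝ) : Matrix (Fin μ × Fin n) (Fin μ × Fin n) ℝ :=
  Matrix.of fun a b => evalNC X (p a.1 b.1) a.2 b.2

/-- The positivity domain of `p` at level `n`: all `X` with `p(X) ⪰ 0`. -/
def posDomainAt {μ g : ℕ} (p : Matrix (Fin μ) (Fin μ) (NCPoly g)) (n : ℕ) :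
    Set (Fin g → Matrix (Fin n) (Fin n) ℝ) :=
  {X | (evalMat p X).PosSemidef}

/-- The positivity domain of `p`: the (disjoint) union over all `n` of its levels. -/
def posDomain {μ g : ℕ} (p : Matrix (Fin μ) (Fin μ) (NCPoly g)) :
    Set (Σ n : ℕ, Fin g → Matrix (Fin n) (Fin n) ℝ) :=
  {X | X.2 ∈ posDomainAt p X.1}

/-- The pencil `A_0 + ∑_{1 ≤ j < s} A_j (x_j + x_j^*) + ∑_{s ≤ j ≤ g} A_j (x_j - x_j^*)`.
The variable `x_j` with `1 ≤ j ≤ g` has the index `j - 1` in `Fin g`. -/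
noncomputable def pencil {μ g : ℕ} (s : ℕ) (A : Fin (g + 1) → Matrix (Fin μ) (Fin μ) ℝ) :
    Matrix (Fin μ) (Fin μ) (NCPoly g) :=
  Matrix.of fun a b =>
    algebraMap ℝ (NCPoly g) (A 0 a b) +
      ∑ j : Fin g, A j.succ a b •
        (if (j.succ : ℕ) < s
          then FreeAlgebra.ι ℝ (Sum.inl j) + FreeAlgebra.ι ℝ (Sum.inr j)
          else FreeAlgebra.ι ℝ (Sum.inl j) - FreeAlgebra.ι ℝ (Sum.inr j))

/-- A symmetric basis `A_0, …, A_{s-1}, A_s, …, A_g` of `𝔄`: the first `s` elements are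
symmetric (among them `A_0`), the others are skew-symmetric. -/
structure IsSymmetricBasis {ν g : ℕ} {𝔄 : Submodule ℝ (Matrix (Fin ν) (Fin ν) ℝ)}
    (A : Module.Basis (Fin (g + 1)) ℝ 𝔄) (s : ℕ) : Prop where
  pos : 1 ≤ s
  le : s ≤ g + 1
  symm : ∀ i : Fin (g + 1), (i : ℕ) < s → Matrix.transpose (A i).1 = (A i).1
  skew : ∀ i : Fin (g + 1), s ≤ (i : ℕ) → Matrix.transpose (A i).1 = -(A i).1

/-! In coordinates, a positive element of `M_k(𝔄)` is a sum `∑ A i ⊗ B i ⪰ 0`, and complete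
positivity says that replacing `A i` by `τ (A i)` preserves positivity (`isCompletelyPositive_iff`).
Values of the pencil are such sums with `B 0 = 1`, so inclusion of domains is the same condition
restricted to monic sums.

Two reductions give the converse. A vector of `ℝ^l ⊗ ℝ^k` is the image of the maximally entangled
vector of `ℝ^l ⊗ ℝ^l` under `1 ⊗ V`, so positivity over `𝔅` can be tested after compressing to level
`l` (`kronSum_dotProduct_mulVec`). At a fixed level, trace-orthogonality forces `B 0 ⪰ 0`; adding `ε
• 1` makes it `Mᵀ * M` with `M` invertible, congruence by `M⁻¹` makes the sum monic, and `ε → 0`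
finishes (`IsSymmetricBasis.kronSum_posSemidef_map`). -/

open Matrix Kronecker MatrixOrder in
theorem trace_mul_nonneg_of_posSemidef {m : Type*} [Fintype m] {P Q : Matrix m m ℝ}
    (hP : P.PosSemidef) (hQ : Q.PosSemidef) : 0 ≤ (P * Q).trace := by
  classical
  obtain ⟨X, rfl⟩ := CStarAlgebra.nonneg_iff_eq_star_mul_self.mp hP.nonneg
  rw [star_eq_conjTranspose, mul_assoc, trace_mul_comm]
  exact (hQ.mul_mul_conjTranspose_same X).trace_nonneg

open MatrixOrder in
theorem Matrix.PosDef.exists_isUnit_transpose_mul_self {m : Type*} [Fintype m] [DecidableEq m]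
    {P : Matrix m m ℝ} (hP : P.PosDef) :
    ∃ M : Matrix m m ℝ, IsUnit M.det ∧ P = M.transpose * M := by
  obtain ⟨M, rfl⟩ := CStarAlgebra.nonneg_iff_eq_star_mul_self.mp hP.posSemidef.nonneg
  refine ⟨M, ?_, by simp [Matrix.star_eq_conjTranspose]⟩
  have h := (Matrix.isUnit_iff_isUnit_det _).mp hP.isUnit
  rw [Matrix.det_mul] at h
  exact isUnit_of_mul_isUnit_right h

/-! ### Kronecker sums: compressions and trace pairings -/

open Matrix Kronecker in
/-- The matrix `∑ i, C i ⊗ B i`. -/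
noncomputable def kronSum {ι m n : Type*} [Fintype ι] (C : ι → Matrix m m ℝ)
    (B : ι → Matrix n n ℝ) : Matrix (m × n) (m × n) ℝ :=
  ∑ i, C i ⊗ₖ B i

section KronSum

variable {ι m n k : Type*} [Fintype ι]

open Matrix Kronecker

theorem kronSum_apply (C : ι → Matrix m m ℝ) (B : ι → Matrix n n ℝ) (a b : m × n) :
    kronSum C B a b = ∑ i, C i a.1 b.1 * B i a.2 b.2 := by
  simp [kronSum, Matrix.sum_apply]

theorem kronSum_conj [Fintype m] [DecidableEq m] [Fintype n] (C : ι → Matrix m m ℝ)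
    (B : ι → Matrix n n ℝ) (M : Matrix n k ℝ) :
    ((1 : Matrix m m ℝ) ⊗ₖ M)ᴴ * kronSum C B * ((1 : Matrix m m ℝ) ⊗ₖ M) =
      kronSum C fun i => Mᵀ * B i * M := by
  simp only [kronSum, Matrix.mul_sum, Matrix.sum_mul, conjTranspose_kronecker,
    ← mul_kronecker_mul, conjTranspose_one, one_mul, mul_one]
  simp only [conjTranspose_eq_transpose_of_trivial]

theorem kronSum_conj_posSemidef [Fintype m] [Fintype n] [Fintype k]
    {C : ι → Matrix m m ℝ} {B : ι → Matrix n n ℝ} (h : (kronSum C B).PosSemidef)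
    (M : Matrix n k ℝ) : (kronSum C fun i => Mᵀ * B i * M).PosSemidef := by
  classical
  rw [← kronSum_conj]
  exact h.conjTranspose_mul_mul_same _

theorem trace_kronecker_mul_kronSum [Fintype m] [Fintype n] (P : Matrix m m ℝ)
    (Q : Matrix n n ℝ) (C : ι → Matrix m m ℝ) (B : ι → Matrix n n ℝ) :
    ((P ⊗ₖ Q) * kronSum C B).trace = ∑ i, (P * C i).trace * (Q * B i).trace := by
  simp only [kronSum, Matrix.mul_sum, trace_sum, ← mul_kronecker_mul, trace_kronecker]

/-- If `∑ C i ⊗ B i` is positive semidefinite and `C i₀` is a nonzero positive semidefinite matrix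
trace-orthogonal to the other `C i`, then `B i₀` has a nonnegative quadratic form. -/
theorem dotProduct_mulVec_nonneg_of_kronSum_posSemidef [Fintype m] [Fintype n]
    {C : ι → Matrix m m ℝ} {B : ι → Matrix n n ℝ} (h : (kronSum C B).PosSemidef) {i₀ : ι}
    (hC : (C i₀).PosSemidef) (hC0 : C i₀ ≠ 0)
    (horth : ∀ i, i ≠ i₀ → (C i₀ * C i).trace = 0) (v : n → ℝ) :
    0 ≤ v ⬝ᵥ (B i₀ *ᵥ v) := by
  have hv : (vecMulVec v v).PosSemidef := posSemidef_vecMulVec_self_star v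
  -- Pairing with `C i₀ ⊗ vvᵀ` kills every other term and leaves `tr (C i₀ ^ 2)` times the quadratic
  -- form of `B i₀` at `v`.
  have h1 := trace_mul_nonneg_of_posSemidef (hC.kronecker hv) h
  rw [trace_kronecker_mul_kronSum, Finset.sum_eq_single i₀ (fun i _ hi => by
    rw [horth i hi, zero_mul]) (by simp)] at h1
  have h2 : 0 < (C i₀ * C i₀).trace := by
    have h3 := trace_mul_nonneg_of_posSemidef hC hC
    refine lt_of_le_of_ne h3 fun h4 => hC0 ?_
    rw [← trace_conjTranspose_mul_self_eq_zero_iff, hC.isHermitian.eq, ← h4]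
  have h5 := nonneg_of_mul_nonneg_right h1 h2
  rwa [trace_mul_comm, mul_vecMulVec, trace_vecMulVec, dotProduct_comm] at h5

/-- The quadratic form of `∑ C i ⊗ B i` at `v` is that of a compression of it to
level `m` at the maximally entangled vector. -/
theorem kronSum_dotProduct_mulVec [Fintype m] [DecidableEq m] [Fintype n]
    (C : ι → Matrix m m ℝ) (B : ι → Matrix n n ℝ) (v : m × n → ℝ) :
    v ⬝ᵥ (kronSum C B *ᵥ v) =
      (fun a : m × m => (1 : Matrix m m ℝ) a.1 a.2) ⬝ᵥ
        ((kronSum C fun i => (Matrix.of fun q a => v (a, q))ᵀ * B i *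
            (Matrix.of fun q a => v (a, q) : Matrix n m ℝ)) *ᵥ
          fun a : m × m => (1 : Matrix m m ℝ) a.1 a.2) := by
  set V : Matrix n m ℝ := Matrix.of fun q a => v (a, q) with hV
  set e : m × m → ℝ := fun a => (1 : Matrix m m ℝ) a.1 a.2 with he
  have hv : v = ((1 : Matrix m m ℝ) ⊗ₖ V) *ᵥ e := by
    ext ⟨a, q⟩
    simp [mulVec, dotProduct, Fintype.sum_prod_type, he, hV, one_apply]
  rw [← kronSum_conj, ← mulVec_mulVec, ← mulVec_mulVec, ← hv, dotProduct_mulVec e,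
    conjTranspose_eq_transpose_of_trivial, vecMul_transpose, ← hv]

theorem kronSum_isHermitian_iff (C : ι → Matrix m m ℝ) (B : ι → Matrix n n ℝ) :
    (kronSum C B).IsHermitian ↔
      kronSum (fun i => (C i)ᵀ) (fun i => (B i)ᵀ) = kronSum C B := by
  simp only [IsHermitian, kronSum, conjTranspose_sum, conjTranspose_kronecker]
  simp only [conjTranspose_eq_transpose_of_trivial]

end KronSum

open Matrix in
theorem evalMat_pencil {μ g n s : ℕ} (C : Fin (g + 1) → Matrix (Fin μ) (Fin μ) ℝ)
    (X : Fin g → Matrix (Fin n) (Fin n) ℝ) :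
    evalMat (pencil s C) X =
      kronSum C (Fin.cons 1 fun j : Fin g => if (j.succ : ℕ) < s then X j + (X j)ᵀ
        else X j - (X j)ᵀ) := by
  ext a b
  rw [kronSum_apply, Fin.sum_univ_succ]
  simp only [evalMat, pencil, Matrix.of_apply, map_add, map_sum, map_smul, AlgHom.commutes,
    Matrix.add_apply, Matrix.sum_apply, Matrix.smul_apply, smul_eq_mul, Fin.cons_zero,
    Fin.cons_succ]
  congr 1
  · simp [Matrix.algebraMap_matrix_apply, Matrix.one_apply]
  · refine Finset.sum_congr rfl fun j _ => ?_
    split_ifs <;> simp [evalNC]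

/-! ### Coordinates in a symmetric basis, and passage between pencils and `M_n(𝔄)` -/

section OperatorSystem

open Matrix Kronecker

variable {ν l g s : ℕ} {𝔄 : Submodule ℝ (Matrix (Fin ν) (Fin ν) ℝ)}
  {𝔅 : Submodule ℝ (Matrix (Fin l) (Fin l) ℝ)}

theorem flatten_posSemidef_iff {k : ℕ} (A : Module.Basis (Fin (g + 1)) ℝ 𝔄) (τ : 𝔄 →ₗ[ℝ] 𝔅)
    (S : Matrix (Fin k) (Fin k) 𝔄) :
    (flatten (S.map τ)).PosSemidef ↔
      (kronSum (fun i => (τ (A i)).1) fun i => Matrix.of fun p q => A.repr (S p q) i).PosSemidef := by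
  -- `flatten` lists the block index first, `kronSum` the coefficient index; the swap reconciles
  -- them.
  rw [← posSemidef_submatrix_equiv (Equiv.prodComm (Fin k) (Fin l))]
  refine iff_of_eq (congrArg _ ?_)
  ext a b
  rw [submatrix_apply, kronSum_apply]
  simp only [flatten, Matrix.of_apply, Matrix.map_apply]
  conv_lhs => rw [← A.sum_repr (S a.1 b.1), map_sum, Submodule.coe_sum, Matrix.sum_apply]
  refine Finset.sum_congr rfl fun i _ => ?_
  rw [map_smul, mul_comm]
  rfl

theorem flatten_posSemidef_iff_kronSum {k : ℕ} (A : Module.Basis (Fin (g + 1)) ℝ 𝔄)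
    (S : Matrix (Fin k) (Fin k) 𝔄) :
    (flatten S).PosSemidef ↔
      (kronSum (fun i => (A i).1) fun i => Matrix.of fun p q => A.repr (S p q) i).PosSemidef :=
  flatten_posSemidef_iff A LinearMap.id S

theorem isCompletelyPositive_iff (A : Module.Basis (Fin (g + 1)) ℝ 𝔄) (τ : 𝔄 →ₗ[ℝ] 𝔅) :
    IsCompletelyPositive τ ↔ ∀ (k : ℕ) (B : Fin (g + 1) → Matrix (Fin k) (Fin k) ℝ),
      (kronSum (fun i => (A i).1) B).PosSemidef →
        (kronSum (fun i => (τ (A i)).1) B).PosSemidef := by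
  constructor
  · intro h k B hB
    have hS : (fun i => Matrix.of fun p q =>
        A.repr ((Matrix.of fun p q => ∑ i, B i p q • A i : Matrix (Fin k) (Fin k) 𝔄) p q) i) =
        B := by
      funext i
      ext p q
      simp only [Matrix.of_apply, A.repr_sum_self]
    have h1 := h.2 k (Matrix.of fun p q => ∑ i, B i p q • A i)
    rw [flatten_posSemidef_iff_kronSum A, flatten_posSemidef_iff A, hS] at h1
    exact h1 hB
  · intro h
    have h2 : ∀ (k : ℕ) (S : Matrix (Fin k) (Fin k) 𝔄),
        (flatten S).PosSemidef → (flatten (S.map τ)).PosSemidef := fun k S hS =>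
      (flatten_posSemidef_iff A τ S).2 (h k _ ((flatten_posSemidef_iff_kronSum A S).1 hS))
    -- Positivity of `τ` itself is the case of `1 × 1` block matrices.
    exact ⟨fun a ha => (h2 1 (Matrix.of fun _ _ => a) (ha.submatrix Prod.snd)).submatrix
      fun i => ((0 : Fin 1), i), h2⟩

/-- Symmetry says that block `(p, q)` is the transpose of block `(q, p)`. Transposition acts on the
basis by signs, so uniqueness of coordinates transfers these signs to the `B i`. -/
theorem IsSymmetricBasis.coeff_transpose {A : Module.Basis (Fin (g + 1)) ℝ 𝔄}
    (hA : IsSymmetricBasis A s) {n : Type*} {B : Fin (g + 1) → Matrix n n ℝ}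
    (h : (kronSum (fun i => (A i).1) B).IsHermitian) (i : Fin (g + 1)) :
    (B i)ᵀ = if (i : ℕ) < s then B i else -B i := by
  ext p q
  have h1 : ∑ i, B i q p • (if (i : ℕ) < s then A i else -A i) = ∑ i, B i p q • A i := by
    apply Subtype.ext
    ext a b
    have h3 := congrFun (congrFun ((kronSum_isHermitian_iff _ _).1 h) (a, p)) (b, q)
    simp only [kronSum_apply, Matrix.transpose_apply] at h3
    simp only [Submodule.coe_sum, Submodule.coe_smul, Matrix.sum_apply, Matrix.smul_apply,
      smul_eq_mul]
    simp only [mul_comm (B _ _ _)]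
    rw [← h3]
    refine Finset.sum_congr rfl fun j _ => ?_
    split_ifs with hj
    · conv_lhs => rw [← hA.symm j hj]
      rfl
    · have := congrFun (congrFun (hA.skew j (not_lt.1 hj)) a) b
      simp only [Matrix.transpose_apply, Matrix.neg_apply] at this
      simp [this]
  have h4 : ∑ i : Fin (g + 1), (if (i : ℕ) < s then B i q p else -B i q p) • A i =
      ∑ i, B i p q • A i := by
    rw [← h1]
    refine Finset.sum_congr rfl fun j _ => ?_
    split_ifs
    · rfl
    · exact (neg_smul (B j q p) (A j)).trans (smul_neg _ _).symm
  have h5 := congrFun (congrArg (fun x => ⇑(A.repr x)) h4) i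
  simp only [A.repr_sum_self] at h5
  rw [Matrix.transpose_apply]
  split_ifs at h5 ⊢ <;> simp [← h5]

theorem IsStarMap.transpose_apply_basis {h𝔄 : IsOperatorSystem 𝔄} {τ : 𝔄 →ₗ[ℝ] 𝔅}
    (hτ : IsStarMap h𝔄 τ) {A : Module.Basis (Fin (g + 1)) ℝ 𝔄} (hA : IsSymmetricBasis A s)
    (i : Fin (g + 1)) :
    (τ (A i)).1ᵀ = if (i : ℕ) < s then (τ (A i)).1 else -(τ (A i)).1 := by
  rw [← hτ (A i)]
  split_ifs with hi
  · congr 2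
    exact Subtype.ext (hA.symm i hi)
  · have : (⟨(A i).1ᵀ, h𝔄 _ (A i).2⟩ : 𝔄) = -A i := Subtype.ext (hA.skew i (not_lt.1 hi))
    rw [this, map_neg]
    rfl

/-- The signs of `(τ (A i))ᵀ` and `(B i)ᵀ` agree, so they cancel in each Kronecker product. -/
theorem IsStarMap.kronSum_isHermitian {h𝔄 : IsOperatorSystem 𝔄} {τ : 𝔄 →ₗ[ℝ] 𝔅}
    (hτ : IsStarMap h𝔄 τ) {A : Module.Basis (Fin (g + 1)) ℝ 𝔄} (hA : IsSymmetricBasis A s)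
    {n : Type*} {B : Fin (g + 1) → Matrix n n ℝ}
    (h : (kronSum (fun i => (A i).1) B).IsHermitian) :
    (kronSum (fun i => (τ (A i)).1) B).IsHermitian := by
  rw [kronSum_isHermitian_iff]
  refine Finset.sum_congr rfl fun i _ => ?_
  dsimp only
  rw [hA.coeff_transpose h, hτ.transpose_apply_basis hA]
  split_ifs
  · rfl
  · ext a b
    simp

/-- Positive semidefinite elements of `M_n(𝔄)` with unit leading coefficient are values of the
pencil. -/
theorem IsSymmetricBasis.exists_evalMat_pencil_eq {A : Module.Basis (Fin (g + 1)) ℝ 𝔄}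
    (hA : IsSymmetricBasis A s) {n : ℕ} {B : Fin (g + 1) → Matrix (Fin n) (Fin n) ℝ}
    (h : (kronSum (fun i => (A i).1) B).IsHermitian) (hB : B 0 = 1) :
    ∃ X : Fin g → Matrix (Fin n) (Fin n) ℝ, ∀ {μ : ℕ} (C : Fin (g + 1) → Matrix (Fin μ) (Fin μ) ℝ),
      evalMat (pencil s C) X = kronSum C B := by
  -- `B j.succ` is symmetric or skew according to `s`, so `X j ± (X j)ᵀ` doubles it. The witness
  -- does not depend on `C`, so one `X` serves both pencils.
  refine ⟨fun j => (1 / 2 : ℝ) • B j.succ, fun C => ?_⟩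
  rw [evalMat_pencil]
  congr 1
  funext i
  refine Fin.cases ?_ (fun j => ?_) i
  · rw [Fin.cons_zero, hB]
  · rw [Fin.cons_succ, transpose_smul, hA.coeff_transpose h]
    split_ifs
    · rw [← add_smul]; norm_num
    · rw [smul_neg, sub_neg_eq_add, ← add_smul]; norm_num

/-- Inclusion of the pencil domains at level `n` yields positivity of `τ` on those positive
semidefinite elements of `M_n(𝔄)` whose leading coefficient is positive definite. -/
theorem IsSymmetricBasis.kronSum_posSemidef_of_posDef {A : Module.Basis (Fin (g + 1)) ℝ 𝔄}
    (hA : IsSymmetricBasis A s) {τ : 𝔄 →ₗ[ℝ] 𝔅} {n : ℕ}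
    (hsub : posDomainAt (pencil s fun i => (A i).1) n ⊆
      posDomainAt (pencil s fun i => (τ (A i)).1) n)
    {B : Fin (g + 1) → Matrix (Fin n) (Fin n) ℝ}
    (h : (kronSum (fun i => (A i).1) B).PosSemidef) (hB : (B 0).PosDef) :
    (kronSum (fun i => (τ (A i)).1) B).PosSemidef := by
  obtain ⟨M, hM, hBM⟩ := hB.exists_isUnit_transpose_mul_self
  have hMt : IsUnit Mᵀ.det := by rwa [det_transpose]
  -- Congruence by `M⁻¹` turns the leading coefficient `Mᵀ * M` into `1`; congruence by `M` undoes
  -- it at the end, on the side of `τ`.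
  have h1 := kronSum_conj_posSemidef h M⁻¹
  obtain ⟨X, hX⟩ := hA.exists_evalMat_pencil_eq h1.isHermitian (by
    rw [hBM, transpose_nonsing_inv, nonsing_inv_mul_cancel_left _ _ hMt, mul_nonsing_inv _ hM])
  have h2 : X ∈ posDomainAt (pencil s fun i => (τ (A i)).1) n := hsub (by
    rw [posDomainAt, Set.mem_ofPred_eq, hX]
    exact h1)
  rw [posDomainAt, Set.mem_ofPred_eq, hX] at h2
  convert kronSum_conj_posSemidef h2 M using 3 with i
  rw [transpose_nonsing_inv, mul_assoc, nonsing_inv_mul_cancel_right _ _ hM,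
    mul_nonsing_inv_cancel_left _ _ hMt]

theorem kronSum_add_single {ι m n : Type*} [Fintype ι] [DecidableEq ι] (C : ι → Matrix m m ℝ)
    (B : ι → Matrix n n ℝ) (i : ι) (P : Matrix n n ℝ) :
    kronSum C (B + Pi.single i P) = kronSum C B + C i ⊗ₖ P := by
  simp only [kronSum, Pi.add_apply, kronecker_add, Finset.sum_add_distrib]
  congr 1
  rw [Finset.sum_eq_single i (fun j _ hj => by rw [Pi.single_eq_of_ne hj, kronecker_zero])
    (by simp), Pi.single_eq_same]

/-- Orthogonality is assumed only among symmetric elements; the trace of a symmetric times a skew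
matrix vanishes on its own. -/
theorem IsSymmetricBasis.trace_mul_eq_zero {A : Module.Basis (Fin (g + 1)) ℝ 𝔄}
    (hA : IsSymmetricBasis A s)
    (horth : ∀ i j : Fin (g + 1), (i : ℕ) < s → (j : ℕ) < s → i ≠ j →
      ((A i).1ᵀ * (A j).1).trace = 0) (i : Fin (g + 1)) (hi : i ≠ 0) :
    ((A 0).1 * (A i).1).trace = 0 := by
  have h0 := hA.symm 0 hA.pos
  by_cases his : (i : ℕ) < s
  · rw [← horth 0 i hA.pos his hi.symm, h0]
  · have h1 := trace_transpose ((A 0).1 * (A i).1)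
    rw [transpose_mul, h0, hA.skew i (not_lt.1 his), neg_mul, trace_neg, trace_mul_comm] at h1
    linarith

theorem IsSymmetricBasis.kronSum_posSemidef_map {A : Module.Basis (Fin (g + 1)) ℝ 𝔄}
    (hA : IsSymmetricBasis A s) {h𝔄 : IsOperatorSystem 𝔄} {τ : 𝔄 →ₗ[ℝ] 𝔅}
    (hτ : IsStarMap h𝔄 τ) (hA0 : (A 0).1.PosSemidef)
    (horth : ∀ i j : Fin (g + 1), (i : ℕ) < s → (j : ℕ) < s → i ≠ j →
      ((A i).1ᵀ * (A j).1).trace = 0) {n : ℕ}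
    (hsub : posDomainAt (pencil s fun i => (A i).1) n ⊆
      posDomainAt (pencil s fun i => (τ (A i)).1) n)
    {B : Fin (g + 1) → Matrix (Fin n) (Fin n) ℝ}
    (h : (kronSum (fun i => (A i).1) B).PosSemidef) :
    (kronSum (fun i => (τ (A i)).1) B).PosSemidef := by
  have hB : (B 0).PosSemidef := by
    refine .of_dotProduct_mulVec_nonneg ?_ fun v => ?_
    · have := hA.coeff_transpose h.isHermitian 0
      rwa [if_pos (by exact hA.pos), ← conjTranspose_eq_transpose_of_trivial] at this
    · exact dotProduct_mulVec_nonneg_of_kronSum_posSemidef h hA0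
        (fun h0 => A.ne_zero 0 (Subtype.ext h0)) (hA.trace_mul_eq_zero horth) v
  -- `B 0` may be singular; adding `ε • 1` to it keeps the sum over `𝔄` positive because `A 0 ⪰ 0`.
  have hpert : ∀ ε : ℝ, 0 < ε → (kronSum (fun i => (τ (A i)).1) B +
      (τ (A 0)).1 ⊗ₖ (ε • (1 : Matrix (Fin n) (Fin n) ℝ))).PosSemidef := by
    intro ε hε
    have hε1 : (ε • (1 : Matrix (Fin n) (Fin n) ℝ)).PosDef := PosDef.one.smul hε
    rw [← kronSum_add_single (fun i => (τ (A i)).1) B 0]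
    refine hA.kronSum_posSemidef_of_posDef hsub ?_ ?_
    · rw [kronSum_add_single]
      exact h.add (hA0.kronecker hε1.posSemidef)
    · rw [Pi.add_apply, Pi.single_eq_same]
      exact PosDef.posSemidef_add hB hε1
  refine .of_dotProduct_mulVec_nonneg (hτ.kronSum_isHermitian hA h.isHermitian) fun v => ?_
  have hlim : Filter.Tendsto (fun ε : ℝ => star v ⬝ᵥ (kronSum (fun i => (τ (A i)).1) B *ᵥ v) +
      ε * (star v ⬝ᵥ (((τ (A 0)).1 ⊗ₖ (1 : Matrix (Fin n) (Fin n) ℝ)) *ᵥ v)))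
      (nhdsWithin 0 (Set.Ioi 0)) (nhds (star v ⬝ᵥ (kronSum (fun i => (τ (A i)).1) B *ᵥ v) +
      0 * (star v ⬝ᵥ (((τ (A 0)).1 ⊗ₖ (1 : Matrix (Fin n) (Fin n) ℝ)) *ᵥ v)))) :=
    (Continuous.tendsto (by fun_prop) 0).mono_left nhdsWithin_le_nhds
  rw [zero_mul, add_zero] at hlim
  refine ge_of_tendsto hlim (Filter.eventually_of_mem self_mem_nhdsWithin fun ε hε => ?_)
  have h1 := (hpert ε hε).dotProduct_mulVec_nonneg v
  rwa [kronecker_smul, add_mulVec, smul_mulVec, dotProduct_add, dotProduct_smul,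
    smul_eq_mul] at h1

end OperatorSystem

theorem theorem7 {ν l g s : ℕ}
    (𝔄 : Submodule ℝ (Matrix (Fin ν) (Fin ν) ℝ)) (𝔅 : Submodule ℝ (Matrix (Fin l) (Fin l) ℝ))
    (h𝔄 : IsOperatorSystem 𝔄) (h𝔅 : IsOperatorSystem 𝔅)
    (τ : 𝔄 →ₗ[ℝ] 𝔅) (hτ : IsStarMap h𝔄 τ)
    (A : Module.Basis (Fin (g + 1)) ℝ 𝔄) (hA : IsSymmetricBasis A s)
    (hA0 : (A 0).1 ∈ psdPart 𝔄)
    (hrank : ∀ C ∈ psdPart 𝔄, C.rank ≤ (A 0).1.rank)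
    (horth : ∀ i j : Fin (g + 1), (i : ℕ) < s → (j : ℕ) < s → i ≠ j →
      (Matrix.transpose (A i).1 * (A j).1).trace = 0) :
    List.TFAE
      [IsCompletelyPositive τ,
        posDomain (pencil s fun i => (A i).1) ⊆ posDomain (pencil s fun i => (τ (A i)).1),
        posDomainAt (pencil s fun i => (A i).1) l ⊆
          posDomainAt (pencil s fun i => (τ (A i)).1) l] := by
  tfae_have 1 → 2 := by
    rintro h ⟨n, X⟩ hX
    simp only [posDomain, posDomainAt, Set.mem_ofPred_eq, evalMat_pencil] at hX ⊢
    exact (isCompletelyPositive_iff A τ).1 h n _ hX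
  tfae_have 2 → 3 := fun h X hX => h (a := ⟨l, X⟩) hX
  tfae_have 3 → 1 := by
    intro h
    rw [isCompletelyPositive_iff A]
    intro k B hB
    refine .of_dotProduct_mulVec_nonneg (hτ.kronSum_isHermitian hA hB.isHermitian) fun v => ?_
    -- The compressed coefficients are `l × l` whatever `k` is, so the hypothesis at level `l`
    -- suffices.
    rw [star_trivial, kronSum_dotProduct_mulVec]
    exact (hA.kronSum_posSemidef_map hτ hA0.2 horth h
      (kronSum_conj_posSemidef hB _)).dotProduct_mulVec_nonneg _
  tfae_finish
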